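/- Let $k$ be a field, let $n\ge 1$ and $m=n-1$. Let $A_{m}$ be the linearly oriented quiver $1\leftarrow 2\leftarrow\cdots\leftarrow m$ and $\operatorname{rep}A_{m}$ the abelian category of its finite-dimensional representations over $k$. For $1\le a\le b\le m$ let $M_{[a,b]}$ be the representation that is $k$ at the vertices $a,\dots,b$ and $0$ elsewhere, with identity maps along the arrows inside the interval. A *torsion pair* in an abelian category is a pair $(\mathcal G,\mathcal F)$ of full subcategories such that $\mathcal G$ consists of all $X$ with $\operatorname{Hom}(X,Y)=0$ for every $Y\in\mathcal F$, and $\mathcal F$ consists of all $Y$ with $\operatorname{Hom}(X,Y)=0$ for every $X\in\mathcal G$; then $\mathcal G$ is called a *torsion class* and $\mathcal F$ the corresponding *torsion-free class*. Let $T$ be a full (plane) binary tree with $n+1$ leaves. Draw it with its leaves at the points $0,1,\dots,n$ of a horizontal line and with all edges of slope $\pm1$: for $a\le b$ let $P(a,b)$ be the point with coordinates $\left(\frac{a+b}{2},\frac{b-a}{2}\right)$, and draw the vertex whose descendant leaves are $p,\dots,q$ at $P(p,q)$ (a leaf $p$ at $P(p,p)$). For $1\le a\le b\le n-1$ the *ball*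 $[a,b]$ is placed directly above $P(a,b)$; it is *on a descending edge* of $T$ if the unit segment from $P(a-1,b)$ down to $P(a,b)$ is part of an edge of $T$, and *on an ascending edge* if the unit segment from $P(a,b)$ up to $P(a,b+1)$ is. Let $\mathcal D_T$ (respectively $\mathcal A_T$) be the set of isomorphism classes of the representations $M_{[a,b]}$ such that the ball $[a,b]$ is on a descending (respectively ascending) edge of $T$. The *Tamari order* on binary trees is the partial order generated by the covering relation $T\lessdot T'$: $T'$ arises from $T$ by replacing one subtree of the form $(XY)Z$ by $X(YZ)$ (a descending edge is moved to the right). **Theorem.** A torsion class in $\operatorname{rep}A_{n-1}$ is determined by the indecomposable objects that it contains, and there is a bijection $f$ from the set of binary trees with $n+1$ leaves to the set of torsion classes in $\operatorname{rep}A_{n-1}$ such that, for every $T$, the indecomposable objects of $f(T)$ are, up to isomorphism, exactly those in $\mathcal D_T$; moreover the indecomposable objects of the corresponding torsion-free class are exactly those in $\mathcal A_T$. In other words, $T\mapsto\mathcal D_T$ is a bijection from the binary trees with $n+1$ leaves onto the torsion classes of $A_{n-1}$. This bijection is order-reversing: if $T\le T'$ in the Tamari order, then $f(T')\subseteq f(T)$,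 and if $T\lessdot T'$, then $f(T')\subsetneq f(T)$. -/

import Mathlib

open CategoryTheory CategoryTheory.Limits

universe u

namespace TreeTorsion

/-! ### Representations of the linearly oriented quiver of type `A` -/

/-- The vertices of the linearly oriented quiver `A_m`. The element `i` of `Fin m` stands for the
vertex usually numbered `i + 1`. -/
def LinearQuiver (m : ℕ) : Type := Fin m

/-- The quiver `A_m : 1 ← 2 ← ⋯ ← m`: there is exactly one arrow `j + 1 ⟶ j` for consecutive
vertices, and there are no other arrows. -/
instance (m : ℕ) : Quiver.{0} (LinearQuiver m) where
  Hom i j := PLift (Fin.val i = Fin.val j + 1)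

/-- The category of finite-dimensional representations over `k` of the quiver `A_m`, as functors
on the free category generated by the quiver. -/
abbrev LinearRep (k : Type u) [Field k] (m : ℕ) : Type (u + 1) :=
  Paths (LinearQuiver m) ⥤ FGModuleCat.{u} k

/-- The space at the vertex `l` of the representation supported on the interval `[i, j]`:
it is `k` if `i ≤ l ≤ j`, and zero otherwise. -/
def intervalSpace (k : Type u) [Field k] {m : ℕ} (i j l : Fin m) : Submodule k k :=
  if i ≤ l ∧ l ≤ j then ⊤ else ⊥

open Classical in
/-- The interval representation supported on the vertices `i, …, j`: one-dimensional at each of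
these vertices and zero at the others, every arrow inside the interval acting as the identity. -/
noncomputable def intervalRep (k : Type u) [Field k] {m : ℕ} (i j : Fin m) : LinearRep k m :=
  Paths.lift
    { obj := fun l : LinearQuiver m => FGModuleCat.of k (intervalSpace k i j l)
      map := fun {l l'} _ => FGModuleCat.ofHom
        (if h : intervalSpace k i j l ≤ intervalSpace k i j l' then Submodule.inclusion h else 0) }

/-! ### Torsion pairs in an abelian category -/

section Torsion

variable {C : Type*} [Category C] [Abelian C]

/-- A torsion pair `(G, F)` of full subcategories of an abelian category: `G` consists of all
objects without nonzero morphisms to objects of `F`, and `F` consists of all objects without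
nonzero morphisms from objects of `G`. -/
structure IsTorsionPair (G F : ObjectProperty C) : Prop where
  torsion_iff : ∀ X : C, G X ↔ ∀ Y : C, F Y → ∀ g : X ⟶ Y, g = 0
  torsionFree_iff : ∀ Y : C, F Y ↔ ∀ X : C, G X → ∀ g : X ⟶ Y, g = 0

/-- A torsion class is the first member of a torsion pair. -/
def IsTorsionClass (G : ObjectProperty C) : Prop :=
  ∃ F : ObjectProperty C, IsTorsionPair G F

/-- The indecomposable objects in a full subcategory. -/
def indecomposables (G : ObjectProperty C) : ObjectProperty C :=
  fun X => G X ∧ Indecomposable X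

end Torsion

/-! ### Binary trees, their edges and the balls on them

A full binary tree is a term of `BinaryTree Unit`: `nil` is a leaf, and `node () l r` is an internal
vertex with left subtree `l` and right subtree `r`. A tree with `n + 1` leaves is drawn with its
leaves at the points `0, 1, …, n` of a horizontal line, all edges having slope `1` or `-1`.
For `a ≤ b` let `P(a, b)` be the upper corner of the right isosceles triangle whose base is the
segment from `a` to `b`. An internal vertex above the leaves `p, …, q` is drawn at `P(p, q)`, and
a leaf `p` at `P(p, p)`.

The ball `[a, b]`, where `1 ≤ a ≤ b ≤ n - 1`, lies directly above `P(a, b)`, in the unit square with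
lower corner `P(a, b)`, left corner `P(a - 1, b)` and right corner `P(a, b + 1)`. So it is on a
descending edge of the tree if the side from `P(a - 1, b)` to `P(a, b)` is part of the tree, and on
an ascending edge if the side from `P(a, b)` to `P(a, b + 1)` is. The bottom row `[1, 1], …` sits
directly above the interior leaves. -/

/-- The pairs `(a, b)` such that the descending unit segment from `P(a - 1, b)` to `P(a, b)` is part
of the drawing of a tree whose leftmost leaf is placed at `p`. The root, above the leaves `p, …, q`,
is joined to its right child, above the leaves `s, …, q`, by the segments with `p < a ≤ s` and
`b = q`; here `s = p + l.numLeaves` and `q = s + r.numNodes`, as a tree has one more leaf than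
internal vertices. -/
def descendingSegments : BinaryTree Unit → ℕ → Set (ℕ × ℕ)
  | .nil, _ => ∅
  | .node _ l r, p =>
      {x | p < x.1 ∧ x.1 ≤ p + l.numLeaves ∧ x.2 = p + l.numLeaves + r.numNodes} ∪
        descendingSegments l p ∪ descendingSegments r (p + l.numLeaves)

/-- The pairs `(a, b)` such that the ascending unit segment from `P(a, b)` to `P(a, b + 1)` is part
of the drawing of a tree whose leftmost leaf is placed at `p`. The root, above the leaves `p, …, q`,
is joined to its left child, above the leaves `p, …, t`, by the segments with `a = p` and
`t ≤ b < q`; here `t = p + l.numNodes` and `q = p + l.numLeaves + r.numNodes`. -/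
def ascendingSegments : BinaryTree Unit → ℕ → Set (ℕ × ℕ)
  | .nil, _ => ∅
  | .node _ l r, p =>
      {x | x.1 = p ∧ p + l.numNodes ≤ x.2 ∧ x.2 < p + l.numLeaves + r.numNodes} ∪
        ascendingSegments l p ∪ ascendingSegments r (p + l.numLeaves)

/-- The objects (up to isomorphism) corresponding to the balls on the descending edges of `T`. The
ball `[a, b]` is the representation of `A_m` with support `{a, …, b}`. -/
def descendingBalls (k : Type u) [Field k] (m : ℕ) (T : BinaryTree Unit) :
    ObjectProperty (LinearRep k m) :=
  fun X => ∃ i j : Fin m, i ≤ j ∧ ((i : ℕ) + 1, (j : ℕ) + 1) ∈ descendingSegments T 0 ∧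
    Nonempty (X ≅ intervalRep k i j)

/-- The objects (up to isomorphism) corresponding to the balls on the ascending edges of `T`. -/
def ascendingBalls (k : Type u) [Field k] (m : ℕ) (T : BinaryTree Unit) :
    ObjectProperty (LinearRep k m) :=
  fun X => ∃ i j : Fin m, i ≤ j ∧ ((i : ℕ) + 1, (j : ℕ) + 1) ∈ ascendingSegments T 0 ∧
    Nonempty (X ≅ intervalRep k i j)

/-! ### The Tamari order -/

/-- The covering relation of the Tamari order: one subtree of the form `(a b) c` is replaced by
`a (b c)`. This shifts one descending edge, the one from the vertex `(a b)` to the root of `b`, to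
the right. -/
inductive TamariCover : BinaryTree Unit → BinaryTree Unit → Prop
  | rotate (a b c : BinaryTree Unit) :
      TamariCover (.node () (.node () a b) c) (.node () a (.node () b c))
  | left {l l' : BinaryTree Unit} (r : BinaryTree Unit) (h : TamariCover l l') :
      TamariCover (.node () l r) (.node () l' r)
  | right (l : BinaryTree Unit) {r r' : BinaryTree Unit} (h : TamariCover r r') :
      TamariCover (.node () l r) (.node () l r')

/-- The Tamari order, generated by the covering relation. -/
def TamariLE : BinaryTree Unit → BinaryTree Unit → Prop :=
  Relation.ReflTransGen TamariCover

end TreeTorsion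

namespace TreeTorsion

/-! ### Closed pairs of sets of intervals -/

/-! Every nonzero representation has an interval representation as a direct summand, so torsion
pairs are controlled by the interval representations they contain. A nonzero morphism from `[a, b]`
to `[c, d]` exists exactly when `a ≤ c ≤ b ≤ d` (`exists_hom_ne_zero_iff`). A torsion pair thus
becomes a pair `(D, E)` of sets of intervals, each the orthogonal of the other for this relation
(`IsTorsionPair.closedPair`, `ClosedPair.isTorsionPair`).

Such pairs have the recursive structure of binary trees. Over the leaves `p, …, q`, let `t + 1` be
the first vertex that no interval of `D` contains (`t + 1 = q` if there is none). Orthogonality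
forces every `[a, t]` into `D` and every `[t + 1, b]` into `E`, and forbids the other intervals that
would meet both sides (`ClosedPair.exists_splitsAt`). What remains is one closed pair on each side
of the split, chosen independently (`SplitsAt.closedPair_restrict`, `SplitsAt.closedPair`). The
segments of a tree split in the same way at the last leaf of the left subtree (`splitsAt_node`). By
induction trees and closed pairs correspond (`closedPair_segments`, `eq_of_descendingSegments`,
`ClosedPair.exists_tree`). Segments with `b = q` or `a = p` carry no ball, so only intervals
strictly between `p` and `q` are compared.

A Tamari rotation deletes the descending segments of one edge and keeps the others, so torsion
classes shrink; strictness follows from injectivity. -/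

/-- The relation satisfied by `x` and `y` when there is a nonzero morphism from the interval
representation of `x` to the one of `y`. -/
def IntervalHom (x y : ℕ × ℕ) : Prop :=
  x.1 ≤ y.1 ∧ y.1 ≤ x.2 ∧ x.2 ≤ y.2

/-- The intervals of vertices strictly between `p` and `q`. -/
def innerIntervals (p q : ℕ) : Set (ℕ × ℕ) :=
  {x | p < x.1 ∧ x.1 ≤ x.2 ∧ x.2 < q}

/-- Among the intervals strictly between `p` and `q`, each of `D` and `E` is the orthogonal of the
other one for the relation `IntervalHom`. -/
structure ClosedPair (p q : ℕ) (D E : Set (ℕ × ℕ)) : Prop where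
  left_iff : ∀ x ∈ innerIntervals p q,
    (x ∈ D ↔ ∀ y ∈ innerIntervals p q, y ∈ E → ¬ IntervalHom x y)
  right_iff : ∀ y ∈ innerIntervals p q,
    (y ∈ E ↔ ∀ x ∈ innerIntervals p q, x ∈ D → ¬ IntervalHom x y)

/-- The pair `(D, E)` has the shape of the segments of a tree over the leaves `p, …, q` whose left
subtree ends at the leaf `t`. -/
structure SplitsAt (p t q : ℕ) (D E : Set (ℕ × ℕ)) : Prop where
  left_le : p ≤ t
  lt_right : t < q
  mem_left : ∀ a, p < a → a ≤ t → (a, t) ∈ D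
  notMem_left : ∀ a b, p < a → a ≤ t + 1 → t + 1 ≤ b → b < q → (a, b) ∉ D
  mem_right : ∀ b, t + 1 ≤ b → b < q → (t + 1, b) ∈ E
  notMem_right : ∀ a b, p < a → a ≤ t → t ≤ b → b < q → (a, b) ∉ E

/-- The splitting point is determined by the first set. -/
lemma SplitsAt.unique {p t t' q : ℕ} {D D' E E' : Set (ℕ × ℕ)}
    (hD : ∀ x ∈ innerIntervals p q, x ∈ D ↔ x ∈ D')
    (h : SplitsAt p t q D E) (h' : SplitsAt p t' q D' E') : t = t' := by
  have := h.left_le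
  have := h.lt_right
  have := h'.left_le
  have := h'.lt_right
  rcases lt_trichotomy t t' with hlt | heq | hlt
  -- The interval `[t + 1, t']` ends at the second split, so it lies in `D'`; it contains `t + 1`,
  -- so it is not in `D`.
  · refine absurd ((hD _ ?_).2 (h'.mem_left (t + 1) (by omega) (by omega)))
      (h.notMem_left _ _ (by omega) (by omega) (by omega) (by omega))
    exact ⟨by dsimp; omega, by dsimp; omega, by dsimp; omega⟩
  · exact heq
  · refine absurd ((hD _ ?_).1 (h.mem_left (t' + 1) (by omega) (by omega)))
      (h'.notMem_left _ _ (by omega) (by omega) (by omega) (by omega))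
    exact ⟨by dsimp; omega, by dsimp; omega, by dsimp; omega⟩

/-- A closed pair splits at the vertex preceding the first one that is not in the support of the
first set. -/
lemma ClosedPair.exists_splitsAt {p q : ℕ} (hpq : p < q) {D E : Set (ℕ × ℕ)}
    (h : ClosedPair p q D E) : ∃ t, SplitsAt p t q D E := by
  classical
  -- The witness `q` only makes the search finite. The value `q - 1` is vacuously admissible too,
  -- which gives `t < q` below.
  have hex : ∃ t, p ≤ t ∧ ∀ a b, p < a → a ≤ t + 1 → t + 1 ≤ b → b < q → (a, b) ∉ D :=
    ⟨q, hpq.le, fun a b _ _ _ _ => by omega⟩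
  obtain ⟨hp, ht⟩ := Nat.find_spec hex
  have hmin : ∀ s < Nat.find hex, p ≤ s →
      ∃ a b, p < a ∧ a ≤ s + 1 ∧ s + 1 ≤ b ∧ b < q ∧ (a, b) ∈ D := by
    intro s hs hps
    have := Nat.find_min hex hs
    push Not at this
    exact this hps
  have htq : Nat.find hex ≤ q - 1 := Nat.find_min' hex ⟨by omega, fun a b _ _ _ _ => by omega⟩
  generalize Nat.find hex = t at *
  have hl : ∀ a, p < a → a ≤ t → (a, t) ∈ D := by
    intro a hpa hat
    rw [h.left_iff _ ⟨hpa, hat, by dsimp; omega⟩]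
    rintro ⟨c, d⟩ ⟨h1, h2, h3⟩ hE ⟨h4, h5, h6⟩
    dsimp only at *
    -- By minimality of `t` some `[x, y]` in `D` contains `c`. It cannot reach `t + 1`, so `x ≤ c ≤
    -- y ≤ t ≤ d`, and it maps nontrivially to `[c, d]` in `E`.
    obtain ⟨x, y, hx, hxc, hcy, hy, hxy⟩ := hmin (c - 1) (by omega) (by omega)
    have hyt : y ≤ t := by
      by_contra hlt
      exact ht x y hx (by omega) (by omega) hy hxy
    exact (h.right_iff _ ⟨h1, h2, h3⟩).1 hE (x, y) ⟨hx, by dsimp; omega, hy⟩ hxy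
      ⟨by dsimp; omega, by dsimp; omega, by dsimp; omega⟩
  refine ⟨t, hp, by omega, hl, ht, ?_, ?_⟩
  · intro b htb hb
    rw [h.right_iff _ ⟨by dsimp; omega, htb, hb⟩]
    rintro ⟨x, y⟩ ⟨h1, h2, h3⟩ hD ⟨h4, h5, h6⟩
    exact ht x y h1 h4 h5 h3 hD
  · intro a b hpa hat htb hb hE
    exact (h.right_iff _ ⟨hpa, by dsimp; omega, hb⟩).1 hE (a, t) ⟨hpa, hat, by dsimp; omega⟩
      (hl a hpa hat) ⟨le_rfl, hat, htb⟩

lemma innerIntervals_mono {p p' q q' : ℕ} (hp : p' ≤ p) (hq : q ≤ q') :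
    innerIntervals p q ⊆ innerIntervals p' q' :=
  fun _ hx => ⟨hp.trans_lt hx.1, hx.2.1, hx.2.2.trans_le hq⟩

/-- A closed pair restricts to closed pairs on both sides of a splitting point. -/
lemma SplitsAt.closedPair_restrict {p t q : ℕ} {D E : Set (ℕ × ℕ)} (hs : SplitsAt p t q D E)
    (h : ClosedPair p q D E) : ClosedPair p t D E ∧ ClosedPair (t + 1) q D E := by
  have hpt := hs.left_le
  have htq := hs.lt_right
  have hL : innerIntervals p t ⊆ innerIntervals p q := innerIntervals_mono le_rfl htq.le
  have hR : innerIntervals (t + 1) q ⊆ innerIntervals p q :=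
    innerIntervals_mono (by omega) le_rfl
  constructor <;> constructor <;> intro x hx
  -- Passing to a smaller range drops test intervals. Those related to `x` either lie in the smaller
  -- range by the inequalities of `IntervalHom`, or cross the split and are excluded by `hs`.
  · rw [h.left_iff x (hL hx)]
    refine ⟨fun H y hy => H y (hL hy), fun H y hy hyE hxy => ?_⟩
    obtain ⟨⟨a, b⟩, c, d⟩ := x, y
    obtain ⟨h1, h2, h3⟩ := hxy
    obtain ⟨h4, h5, h6⟩ := hx
    obtain ⟨h7, h8, h9⟩ := hy
    dsimp only at *
    by_cases hdt : d < t
    · exact H _ ⟨h7, h8, hdt⟩ hyE ⟨h1, h2, h3⟩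
    · exact hs.notMem_right c d h7 (by omega) (by omega) h9 hyE
  · rw [h.right_iff x (hL hx)]
    refine ⟨fun H y hy => H y (hL hy), fun H y hy hyD hyx => ?_⟩
    obtain ⟨⟨c, d⟩, a, b⟩ := x, y
    obtain ⟨h1, h2, h3⟩ := hyx
    obtain ⟨h4, h5, h6⟩ := hx
    obtain ⟨h7, h8, h9⟩ := hy
    dsimp only at *
    exact H (a, b) ⟨h7, h8, by dsimp; omega⟩ hyD ⟨h1, h2, h3⟩
  · rw [h.left_iff x (hR hx)]
    refine ⟨fun H y hy => H y (hR hy), fun H y hy hyE hxy => ?_⟩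
    obtain ⟨⟨a, b⟩, c, d⟩ := x, y
    obtain ⟨h1, h2, h3⟩ := hxy
    obtain ⟨h4, h5, h6⟩ := hx
    obtain ⟨h7, h8, h9⟩ := hy
    dsimp only at *
    exact H (c, d) ⟨by dsimp; omega, h8, h9⟩ hyE ⟨h1, h2, h3⟩
  · rw [h.right_iff x (hR hx)]
    refine ⟨fun H y hy => H y (hR hy), fun H y hy hyD hyx => ?_⟩
    obtain ⟨⟨c, d⟩, a, b⟩ := x, y
    obtain ⟨h1, h2, h3⟩ := hyx
    obtain ⟨h4, h5, h6⟩ := hx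
    obtain ⟨h7, h8, h9⟩ := hy
    dsimp only at *
    by_cases hat : t + 1 < a
    · exact H (a, b) ⟨hat, h8, h9⟩ hyD ⟨h1, h2, h3⟩
    · exact hs.notMem_left a b h7 (by omega) (by omega) h9 hyD

/-- Closed pairs on both sides of a splitting point fit together to a closed pair. -/
lemma SplitsAt.closedPair {p t q : ℕ} {D E : Set (ℕ × ℕ)} (hs : SplitsAt p t q D E)
    (hl : ClosedPair p t D E) (hr : ClosedPair (t + 1) q D E) : ClosedPair p q D E := by
  have hpt := hs.left_le
  have htq := hs.lt_right
  have key : ∀ x ∈ innerIntervals p q, ∀ y ∈ innerIntervals p q, x ∈ D → y ∈ E →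
      ¬ IntervalHom x y := by
    rintro ⟨a, b⟩ ⟨h1, h2, h3⟩ ⟨c, d⟩ ⟨h4, h5, h6⟩ hD hE ⟨h7, h8, h9⟩
    dsimp only at *
    rcases lt_or_ge d t with hd | hd
    · exact (hl.left_iff (a, b) ⟨h1, h2, by dsimp; omega⟩).1 hD (c, d) ⟨h4, h5, hd⟩ hE
        ⟨h7, h8, h9⟩
    rcases le_or_gt c t with hc | hc
    · exact hs.notMem_right c d h4 hc hd h6 hE
    rcases le_or_gt a (t + 1) with ha | ha
    · exact hs.notMem_left a b h1 ha (by omega) h3 hD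
    · exact (hr.left_iff (a, b) ⟨ha, h2, h3⟩).1 hD (c, d) ⟨by dsimp; omega, h5, h6⟩ hE
        ⟨h7, h8, h9⟩
  have hL : innerIntervals p t ⊆ innerIntervals p q := innerIntervals_mono le_rfl htq.le
  have hR : innerIntervals (t + 1) q ⊆ innerIntervals p q :=
    innerIntervals_mono (by omega) le_rfl
  constructor
  · rintro ⟨a, b⟩ hx
    refine ⟨fun hD y hy hE => key _ hx _ hy hD hE, fun H => ?_⟩
    obtain ⟨h1, h2, h3⟩ := hx
    dsimp only at *
    rcases lt_trichotomy b t with hb | hb | hb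
    · exact (hl.left_iff (a, b) ⟨h1, h2, hb⟩).2 fun y hy => H y (hL hy)
    · subst hb
      exact hs.mem_left a h1 h2
    rcases le_or_gt a (t + 1) with ha | ha
    -- An interval containing `t + 1` maps nontrivially to `[t + 1, b]`, which is in `E`.
    · exact absurd ⟨ha, hb, le_rfl⟩
        (H (t + 1, b) ⟨by dsimp; omega, hb, h3⟩ (hs.mem_right b hb h3))
    · exact (hr.left_iff (a, b) ⟨ha, h2, h3⟩).2 fun y hy => H y (hR hy)
  · rintro ⟨c, d⟩ hy
    refine ⟨fun hE x hx hD => key _ hx _ hy hD hE, fun H => ?_⟩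
    obtain ⟨h1, h2, h3⟩ := hy
    dsimp only at *
    rcases lt_or_ge d t with hd | hd
    · exact (hl.right_iff (c, d) ⟨h1, h2, hd⟩).2 fun x hx => H x (hL hx)
    rcases lt_trichotomy c (t + 1) with hc | hc | hc
    -- Dually, `[c, t]` lies in `D` and maps nontrivially to `[c, d]`.
    · exact absurd ⟨le_rfl, by dsimp; omega, hd⟩
        (H (c, t) ⟨h1, by dsimp; omega, htq⟩ (hs.mem_left c h1 (by omega)))
    · subst hc
      exact hs.mem_right d h2 h3
    · exact (hr.right_iff (c, d) ⟨hc, h2, h3⟩).2 fun x hx => H x (hR hx)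

lemma ClosedPair.congr {p q : ℕ} {D D' E E' : Set (ℕ × ℕ)} (h : ClosedPair p q D E)
    (hD : ∀ x ∈ innerIntervals p q, x ∈ D' ↔ x ∈ D)
    (hE : ∀ x ∈ innerIntervals p q, x ∈ E' ↔ x ∈ E) : ClosedPair p q D' E' where
  left_iff x hx := by
    rw [hD x hx, h.left_iff x hx]
    exact forall₂_congr fun y hy => by rw [hE y hy]
  right_iff x hx := by
    rw [hE x hx, h.right_iff x hx]
    exact forall₂_congr fun y hy => by rw [hD y hy]

lemma closedPair_of_le {p q : ℕ} (hpq : q ≤ p) (D E : Set (ℕ × ℕ)) : ClosedPair p q D E := by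
  constructor <;> rintro x ⟨h1, h2, h3⟩ <;> omega

/-! ### The segments of a binary tree -/

lemma bounds_of_mem_descendingSegments {T : BinaryTree Unit} {p : ℕ} {x : ℕ × ℕ}
    (h : x ∈ descendingSegments T p) : p < x.1 ∧ x.1 ≤ x.2 ∧ x.2 ≤ p + T.numNodes := by
  induction T generalizing p with
  | nil => exact h.elim
  | node _ l r ihl ihr =>
    simp only [BinaryTree.numNodes]
    have hl := l.numLeaves_eq_numNodes_succ
    rcases h with (h | h) | h
    · simp only [Set.mem_ofPred_eq] at h
      omega
    · have := ihl h
      omega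
    · have := ihr h
      omega

lemma bounds_of_mem_ascendingSegments {T : BinaryTree Unit} {p : ℕ} {x : ℕ × ℕ}
    (h : x ∈ ascendingSegments T p) : p ≤ x.1 ∧ x.1 ≤ x.2 ∧ x.2 < p + T.numNodes := by
  induction T generalizing p with
  | nil => exact h.elim
  | node _ l r ihl ihr =>
    simp only [BinaryTree.numNodes]
    have hl := l.numLeaves_eq_numNodes_succ
    rcases h with (h | h) | h
    · simp only [Set.mem_ofPred_eq] at h
      omega
    · have := ihl h
      omega
    · have := ihr h
      omega

/-- The segments on the edges from the root to the last leaf. -/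
lemma mem_descendingSegments_last (T : BinaryTree Unit) {p a : ℕ} (ha : p < a)
    (haT : a ≤ p + T.numNodes) : (a, p + T.numNodes) ∈ descendingSegments T p := by
  induction T generalizing p with
  | nil => simp only [BinaryTree.numNodes] at haT; omega
  | node _ l r ihl ihr =>
    simp only [BinaryTree.numNodes] at haT ⊢
    have hl := l.numLeaves_eq_numNodes_succ
    rcases le_or_gt a (p + l.numLeaves) with h | h
    · exact Or.inl (Or.inl ⟨ha, h, by dsimp; omega⟩)
    · refine Or.inr ?_
      have := ihr h (by omega)
      rwa [show p + l.numLeaves + r.numNodes = p + (l.numNodes + r.numNodes + 1) by omega] at this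

/-- The segments on the edges from the root to the first leaf. -/
lemma mem_ascendingSegments_first (T : BinaryTree Unit) {p b : ℕ} (hb : p ≤ b)
    (hbT : b < p + T.numNodes) : (p, b) ∈ ascendingSegments T p := by
  induction T generalizing p with
  | nil => simp only [BinaryTree.numNodes] at hbT; omega
  | node _ l r ihl ihr =>
    simp only [BinaryTree.numNodes] at hbT
    have hl := l.numLeaves_eq_numNodes_succ
    rcases lt_or_ge b (p + l.numNodes) with h | h
    · exact Or.inl (Or.inr (ihl hb h))
    · exact Or.inl (Or.inl ⟨rfl, h, by dsimp; omega⟩)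

/-- The edge at the root lies on the outer boundary (`b = q`, or `a = p` for ascending segments),
and the other subtree stands over other leaves. The same reason serves the three variants below. -/
lemma mem_descendingSegments_node_left (l r : BinaryTree Unit) {p : ℕ} {x : ℕ × ℕ}
    (hx : x ∈ innerIntervals p (p + l.numNodes)) :
    x ∈ descendingSegments (.node () l r) p ↔ x ∈ descendingSegments l p := by
  have hl := l.numLeaves_eq_numNodes_succ
  obtain ⟨h1, h2, h3⟩ := hx
  refine ⟨fun h => ?_, fun h => Or.inl (Or.inr h)⟩
  rcases h with (h | h) | h
  · simp only [Set.mem_ofPred_eq] at h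
    omega
  · exact h
  · have := bounds_of_mem_descendingSegments h
    omega

lemma mem_descendingSegments_node_right (l r : BinaryTree Unit) {p : ℕ} {x : ℕ × ℕ}
    (hx : x ∈ innerIntervals (p + l.numNodes + 1) (p + l.numNodes + 1 + r.numNodes)) :
    x ∈ descendingSegments (.node () l r) p ↔ x ∈ descendingSegments r (p + l.numNodes + 1) := by
  have hl := l.numLeaves_eq_numNodes_succ
  rw [add_assoc p, ← hl] at hx ⊢
  obtain ⟨h1, h2, h3⟩ := hx
  refine ⟨fun h => ?_, fun h => Or.inr h⟩
  rcases h with (h | h) | h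
  · simp only [Set.mem_ofPred_eq] at h
    omega
  · have := bounds_of_mem_descendingSegments h
    omega
  · exact h

lemma mem_ascendingSegments_node_left (l r : BinaryTree Unit) {p : ℕ} {x : ℕ × ℕ}
    (hx : x ∈ innerIntervals p (p + l.numNodes)) :
    x ∈ ascendingSegments (.node () l r) p ↔ x ∈ ascendingSegments l p := by
  have hl := l.numLeaves_eq_numNodes_succ
  obtain ⟨h1, h2, h3⟩ := hx
  refine ⟨fun h => ?_, fun h => Or.inl (Or.inr h)⟩
  rcases h with (h | h) | h
  · simp only [Set.mem_ofPred_eq] at h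
    omega
  · exact h
  · have := bounds_of_mem_ascendingSegments h
    omega

lemma mem_ascendingSegments_node_right (l r : BinaryTree Unit) {p : ℕ} {x : ℕ × ℕ}
    (hx : x ∈ innerIntervals (p + l.numNodes + 1) (p + l.numNodes + 1 + r.numNodes)) :
    x ∈ ascendingSegments (.node () l r) p ↔ x ∈ ascendingSegments r (p + l.numNodes + 1) := by
  have hl := l.numLeaves_eq_numNodes_succ
  rw [add_assoc p, ← hl] at hx ⊢
  obtain ⟨h1, h2, h3⟩ := hx
  refine ⟨fun h => ?_, fun h => Or.inr h⟩
  rcases h with (h | h) | h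
  · simp only [Set.mem_ofPred_eq] at h
    omega
  · have := bounds_of_mem_ascendingSegments h
    omega
  · exact h

/-- The intervals `[a, t]` come from the path from the root of `l` to its last leaf, the intervals
`[t + 1, b]` from the path from the root of `r` to its first leaf. -/
lemma splitsAt_node (l r : BinaryTree Unit) (p : ℕ) :
    SplitsAt p (p + l.numNodes) (p + l.numNodes + 1 + r.numNodes)
      (descendingSegments (.node () l r) p) (ascendingSegments (.node () l r) p) := by
  have hl := l.numLeaves_eq_numNodes_succ
  refine ⟨by omega, by omega, ?_, ?_, ?_, ?_⟩
  · exact fun a ha hat => Or.inl (Or.inr (mem_descendingSegments_last l ha hat))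
  · rintro a b h1 h2 h3 h4 ((h | h) | h)
    · simp only [Set.mem_ofPred_eq] at h
      omega
    · have := bounds_of_mem_descendingSegments h
      dsimp only at this
      omega
    · have := bounds_of_mem_descendingSegments h
      dsimp only at this
      omega
  · intro b h1 h2
    refine Or.inr ?_
    rw [hl, ← add_assoc]
    exact mem_ascendingSegments_first r h1 h2
  · rintro a b h1 h2 h3 h4 ((h | h) | h)
    · simp only [Set.mem_ofPred_eq] at h
      omega
    · have := bounds_of_mem_ascendingSegments h
      dsimp only at this
      omega
    · have := bounds_of_mem_ascendingSegments h
      dsimp only at this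
      omega

/-- The descending and the ascending segments of a tree form a closed pair. -/
lemma closedPair_segments (T : BinaryTree Unit) (p : ℕ) :
    ClosedPair p (p + T.numNodes) (descendingSegments T p) (ascendingSegments T p) := by
  induction T generalizing p with
  | nil => exact closedPair_of_le (by simp [BinaryTree.numNodes]) _ _
  | node _ l r ihl ihr =>
    rw [show p + (BinaryTree.node () l r).numNodes = p + l.numNodes + 1 + r.numNodes by
      simp only [BinaryTree.numNodes]; omega]
    exact (splitsAt_node l r p).closedPair
      ((ihl p).congr (fun _ => mem_descendingSegments_node_left l r)
        (fun _ => mem_ascendingSegments_node_left l r))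
      ((ihr _).congr (fun _ => mem_descendingSegments_node_right l r)
        (fun _ => mem_ascendingSegments_node_right l r))

/-- A tree is determined by its size and its inner descending segments. -/
lemma eq_of_descendingSegments {T T' : BinaryTree Unit} {p : ℕ} (hn : T.numNodes = T'.numNodes)
    (h : ∀ x ∈ innerIntervals p (p + T.numNodes),
      x ∈ descendingSegments T p ↔ x ∈ descendingSegments T' p) : T = T' := by
  induction T generalizing T' p with
  | nil =>
    cases T' with
    | nil => rfl
    | node _ l r => simp [BinaryTree.numNodes] at hn
  | node _ l r ihl ihr =>
    cases T' with
    | nil => simp [BinaryTree.numNodes] at hn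
    | node _ l' r' =>
      simp only [BinaryTree.numNodes] at hn h
      have hs := splitsAt_node l r p
      have hs' := splitsAt_node l' r' p
      rw [show p + l'.numNodes + 1 + r'.numNodes = p + l.numNodes + 1 + r.numNodes by omega] at hs'
      rw [show p + (l.numNodes + r.numNodes + 1) = p + l.numNodes + 1 + r.numNodes by omega] at h
      -- The split is at `p + l.numNodes`, so its uniqueness fixes the size of the left subtree.
      have hll : l.numNodes = l'.numNodes := by
        have := SplitsAt.unique h hs hs'
        omega
      have hrr : r.numNodes = r'.numNodes := by omega
      congr 1
      · refine ihl (p := p) hll fun x hx => ?_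
        rw [← mem_descendingSegments_node_left l r hx,
          h x (innerIntervals_mono le_rfl (by omega) hx),
          mem_descendingSegments_node_left l' r' (hll ▸ hx)]
      · refine ihr (p := p + l.numNodes + 1) hrr fun x hx => ?_
        rw [← mem_descendingSegments_node_right l r hx,
          h x (innerIntervals_mono (by omega) le_rfl hx), hll,
          mem_descendingSegments_node_right l' r' (by rwa [hll, hrr] at hx)]

/-- Every closed pair comes from a tree. -/
lemma ClosedPair.exists_tree {p q : ℕ} (hpq : p ≤ q) {D E : Set (ℕ × ℕ)}
    (h : ClosedPair p q D E) : ∃ T : BinaryTree Unit, p + T.numNodes = q ∧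
      ∀ x ∈ innerIntervals p q, x ∈ descendingSegments T p ↔ x ∈ D := by
  induction hd : q - p using Nat.strong_induction_on generalizing p q with
  | _ d ih =>
    rcases hpq.eq_or_lt with rfl | hlt
    · exact ⟨.nil, rfl, by rintro x ⟨h1, h2, h3⟩; omega⟩
    obtain ⟨t, hs⟩ := h.exists_splitsAt hlt
    have hpt := hs.left_le
    have htq := hs.lt_right
    obtain ⟨hl, hr⟩ := hs.closedPair_restrict h
    obtain ⟨l, hlt, hlD⟩ := ih (t - p) (by omega) hpt hl rfl
    obtain ⟨r, hrq, hrD⟩ := ih (q - (t + 1)) (by omega) htq hr rfl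
    subst hlt hrq
    refine ⟨.node () l r, by simp only [BinaryTree.numNodes]; omega, ?_⟩
    have hs' := splitsAt_node l r p
    rintro ⟨a, b⟩ ⟨h1, h2, h3⟩
    dsimp only at h1 h2 h3
    rcases lt_trichotomy b (p + l.numNodes) with hb | hb | hb
    · rw [mem_descendingSegments_node_left l r ⟨h1, h2, hb⟩, hlD _ ⟨h1, h2, hb⟩]
    · subst hb
      exact iff_of_true (hs'.mem_left a h1 h2) (hs.mem_left a h1 h2)
    rcases le_or_gt a (p + l.numNodes + 1) with ha | ha
    · exact iff_of_false (hs'.notMem_left a b h1 ha hb h3) (hs.notMem_left a b h1 ha hb h3)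
    · rw [mem_descendingSegments_node_right l r ⟨ha, h2, h3⟩, hrD _ ⟨ha, h2, h3⟩]

/-! ### The Tamari order -/

lemma TamariCover.numNodes_eq {T T' : BinaryTree Unit} (h : TamariCover T T') :
    T'.numNodes = T.numNodes := by
  induction h with
  | rotate a b c => simp only [BinaryTree.numNodes]; omega
  | left r _ ih => simp only [BinaryTree.numNodes]; omega
  | right l _ ih => simp only [BinaryTree.numNodes]; omega

lemma TamariCover.ne {T T' : BinaryTree Unit} (h : TamariCover T T') : T ≠ T' := by
  induction h with
  | rotate a b c =>
    intro h
    have := congrArg BinaryTree.numNodes (BinaryTree.node.inj h).2.1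
    simp only [BinaryTree.numNodes] at this
    omega
  | left r _ ih => exact fun h => ih (BinaryTree.node.inj h).2.1
  | right l _ ih => exact fun h => ih (BinaryTree.node.inj h).2.2

/-- Rotations in the direction of the Tamari order remove descending segments. -/
lemma TamariCover.descendingSegments_subset {T T' : BinaryTree Unit} (h : TamariCover T T')
    (p : ℕ) : descendingSegments T' p ⊆ descendingSegments T p := by
  induction h generalizing p with
  | rotate a b c =>
    have ha := a.numLeaves_eq_numNodes_succ
    have hb := b.numLeaves_eq_numNodes_succ
    intro x hx
    simp only [descendingSegments, BinaryTree.numLeaves, BinaryTree.numNodes, Set.mem_union,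
      Set.mem_ofPred_eq, ← add_assoc] at hx ⊢
    -- The two root edges of `a (b c)` and of its subtree `b c` both end at the last leaf; together
    -- they make up the root edge of `(a b) c`.
    rcases hx with (hx | hx) | ((hx | hx) | hx)
    · exact Or.inl (Or.inl (by omega))
    · exact Or.inl (Or.inr (Or.inl (Or.inr hx)))
    · exact Or.inl (Or.inl (by omega))
    · exact Or.inl (Or.inr (Or.inr hx))
    · exact Or.inr hx
  | @left l l' r hc ih =>
    have hn : l'.numLeaves = l.numLeaves := by
      rw [l.numLeaves_eq_numNodes_succ, l'.numLeaves_eq_numNodes_succ, hc.numNodes_eq]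
    simp only [descendingSegments, hn]
    exact Set.union_subset_union_left _ (Set.union_subset_union_right _ (ih p))
  | @right l r r' hc ih =>
    simp only [descendingSegments, hc.numNodes_eq]
    exact Set.union_subset_union_right _ (ih _)

lemma TamariLE.descendingSegments_subset {T T' : BinaryTree Unit} (h : TamariLE T T') (p : ℕ) :
    descendingSegments T' p ⊆ descendingSegments T p := by
  induction h with
  | refl => exact subset_rfl
  | tail _ hc ih => exact (hc.descendingSegments_subset p).trans ih

/-! ### Paths in the linear quiver -/

/-- A vertex of the linear quiver as an object of its path category. -/
def vertex {m : ℕ} (l : Fin m) : Paths (LinearQuiver m) := l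

lemma le_of_path {m : ℕ} {i j : Fin m} (p : vertex j ⟶ vertex i) : i ≤ j := by
  change @Quiver.Path (LinearQuiver m) _ j i at p
  induction p with
  | nil => exact le_rfl
  | @cons b c _ e ih =>
    have := e.down
    have ih : Fin.val b ≤ Fin.val j := ih
    change Fin.val c ≤ Fin.val j
    omega

/-- Each arrow lowers the vertex by one, so source and target determine a path. Hence the choice
made in `path` is harmless and composites of paths can be identified freely. -/
instance {m : ℕ} (i j : Paths (LinearQuiver m)) : Subsingleton (i ⟶ j) := by
  refine ⟨fun p q => ?_⟩
  change @Quiver.Path (LinearQuiver m) _ i j at p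
  change @Quiver.Path (LinearQuiver m) _ i j at q
  change p = q
  induction p with
  | nil =>
    cases q with
    | nil => rfl
    | @cons b _ q e =>
      have h1 := e.down
      have h2 : Fin.val b ≤ Fin.val i := le_of_path (i := b) (j := i) q
      omega
  | @cons b c p e ih =>
    cases q with
    | nil =>
      have h1 := e.down
      have h2 := le_of_path (i := b) (j := i) p
      change Fin.val b ≤ Fin.val i at h2
      omega
    | @cons b' _ q e' =>
      have h1 := e.down
      have h2 := e'.down
      obtain rfl : b = b' := Fin.ext (by omega)
      obtain rfl : e = e' := Subsingleton.elim (α := PLift _) _ _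
      rw [ih q]

lemma nonempty_path {m : ℕ} {i j : Fin m} (h : i ≤ j) : Nonempty (vertex j ⟶ vertex i) := by
  induction hd : (j : ℕ) - i generalizing i with
  | zero =>
    obtain rfl : i = j := Fin.ext (by have : (i : ℕ) ≤ j := h; omega)
    exact ⟨𝟙 _⟩
  | succ d ih =>
    obtain ⟨p⟩ := @ih ⟨i + 1, by omega⟩ (show (i : ℕ) + 1 ≤ j by omega) (by dsimp; omega)
    exact ⟨p ≫ (Paths.of (LinearQuiver m)).map
      (show @Quiver.Hom (LinearQuiver m) _ ⟨i + 1, by omega⟩ i from ⟨rfl⟩)⟩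

/-- The path between two vertices of the linear quiver. -/
noncomputable def path {m : ℕ} {i j : Fin m} (h : i ≤ j) : vertex j ⟶ vertex i :=
  (nonempty_path h).some

variable {k : Type u} [Field k] {m : ℕ}

/-! ### Linear algebra of representations -/

/-- The linear map by which a path acts on a representation. -/
abbrev act (X : LinearRep k m) {i j : Paths (LinearQuiver m)} (p : i ⟶ j) :
    X.obj i →ₗ[k] X.obj j :=
  (X.map p).hom.hom

/-- The component at a vertex of a morphism of representations. -/
abbrev comp {X Y : LinearRep k m} (g : X ⟶ Y) (i : Paths (LinearQuiver m)) :
    X.obj i →ₗ[k] Y.obj i :=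
  (g.app i).hom.hom

lemma act_comp_apply (X : LinearRep k m) {i j l : Paths (LinearQuiver m)} (p : i ⟶ j)
    (q : j ⟶ l) (x : X.obj i) : act X (p ≫ q) x = act X q (act X p x) := by
  simp [act]

lemma act_id_apply (X : LinearRep k m) {i : Paths (LinearQuiver m)} (p : i ⟶ i)
    (x : X.obj i) : act X p x = x := by
  rw [Subsingleton.elim p (𝟙 i)]
  simp [act]

lemma comp_act_apply {X Y : LinearRep k m} (g : X ⟶ Y) {i j : Paths (LinearQuiver m)}
    (p : i ⟶ j) (x : X.obj i) : comp g j (act X p x) = act Y p (comp g i x) := by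
  exact congrArg (fun f : X.obj i ⟶ Y.obj j => f.hom.hom x) (g.naturality p)

lemma comp_comp_apply {X Y Z : LinearRep k m} (g : X ⟶ Y) (h : Y ⟶ Z)
    (i : Paths (LinearQuiver m)) (x : X.obj i) : comp (g ≫ h) i x = comp h i (comp g i x) := by
  simp [comp]

lemma hom_ext_comp {X Y : LinearRep k m} {g h : X ⟶ Y}
    (H : ∀ (l : Fin m) (x : X.obj (vertex l)), comp g (vertex l) x = comp h (vertex l) x) :
    g = h := by
  ext l : 2
  exact FGModuleCat.hom_ext (LinearMap.ext (H l))

/-- A morphism of representations from its components. -/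
def mkHom {X Y : LinearRep k m} (φ : ∀ l : Fin m, X.obj (vertex l) →ₗ[k] Y.obj (vertex l))
    (H : ∀ {l l' : Fin m} (p : vertex l ⟶ vertex l') (x : X.obj (vertex l)),
      φ l' (act X p x) = act Y p (φ l x)) : X ⟶ Y where
  app l := ObjectProperty.homMk (ModuleCat.ofHom (φ l))
  naturality l l' p := FGModuleCat.hom_ext (LinearMap.ext fun x => H (l := l) (l' := l') p x)

@[simp]
lemma comp_mkHom {X Y : LinearRep k m} (φ : ∀ l : Fin m, X.obj (vertex l) →ₗ[k] Y.obj (vertex l))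
    (H) (l : Fin m) : comp (mkHom (X := X) (Y := Y) φ H) (vertex l) = φ l := rfl

/-! ### Interval representations -/

/-- An element of an interval representation as a scalar. -/
noncomputable def coord {i j l : Fin m} : (intervalRep k i j).obj (vertex l) →ₗ[k] k :=
  (intervalSpace k i j l).subtype

lemma coord_injective {i j l : Fin m} :
    Function.Injective (coord : (intervalRep k i j).obj (vertex l) →ₗ[k] k) :=
  Subtype.val_injective

lemma coord_eq_zero {i j l : Fin m} (h : ¬ (i ≤ l ∧ l ≤ j))
    (x : (intervalRep k i j).obj (vertex l)) : coord x = 0 := by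
  obtain ⟨x, hx⟩ := x
  have hbot : intervalSpace k i j l = ⊥ := if_neg h
  exact (Submodule.mem_bot k).1 (hbot ▸ hx)

/-- The element of an interval representation with a given scalar as its coordinate. -/
noncomputable def single {i j l : Fin m} (h : i ≤ l ∧ l ≤ j) :
    k →ₗ[k] (intervalRep k i j).obj (vertex l) :=
  (LinearMap.id : k →ₗ[k] k).codRestrict (intervalSpace k i j l)
    (fun c => by simp [intervalSpace, h])

@[simp]
lemma coord_single {i j l : Fin m} (h : i ≤ l ∧ l ≤ j) (c : k) :
    coord (single h c : (intervalRep k i j).obj (vertex l)) = c := rfl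

lemma intervalSpace_mono (k : Type u) [Field k] {i j l l' : Fin m} (hi : i ≤ l') (hl : l' ≤ l) :
    intervalSpace k i j l ≤ intervalSpace k i j l' := by
  by_cases hlj : l ≤ j
  · exact le_top.trans_eq (if_pos ⟨hi, hl.trans hlj⟩ : intervalSpace k i j l' = ⊤).symm
  · have hbot : intervalSpace k i j l = ⊥ := if_neg fun h => hlj h.2
    exact hbot.trans_le bot_le

open Classical in
lemma intervalRep_map_of (i j : Fin m) {l l' : LinearQuiver m} (e : l ⟶ l') :
    (intervalRep k i j).map ((Paths.of _).map e) = FGModuleCat.ofHom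
      (if h : intervalSpace k i j l ≤ intervalSpace k i j l' then Submodule.inclusion h else 0) :=
  Paths.lift_toPath _ e

lemma coord_act_of {i j : Fin m} {l l' : LinearQuiver m} (e : l ⟶ l')
    (x : (intervalRep k i j).obj (vertex l)) :
    coord (act (intervalRep k i j) (i := vertex l) (j := vertex l') ((Paths.of _).map e) x) =
      if Fin.val i ≤ Fin.val l' then coord x else 0 := by
  have hll : Fin.val l = Fin.val l' + 1 := e.down
  split_ifs with hc
  · have hle : intervalSpace k i j l ≤ intervalSpace k i j l' :=
      intervalSpace_mono k hc (show Fin.val l' ≤ Fin.val l by omega)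
    have hmap := (intervalRep_map_of (k := k) i j e).trans
      (congrArg FGModuleCat.ofHom (dif_pos hle))
    exact congrArg (fun f => coord (l := l') (f.hom.hom x)) hmap
  · exact coord_eq_zero (fun h' => hc h'.1) _

/-- Only the lower end needs a test: if `l` lies above `j`, then `coord x` is already zero. -/
lemma coord_act {i j l l' : Fin m} (p : vertex l ⟶ vertex l')
    (x : (intervalRep k i j).obj (vertex l)) :
    coord (act (intervalRep k i j) p x) = if i ≤ l' then coord x else 0 := by
  refine Paths.induction_fixed_source (a := vertex l)
    (fun {b : Fin m} p => coord (act (intervalRep k i j) (i := vertex l) (j := vertex b) p x) =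
      if i ≤ b then coord x else 0) ?_ (fun {u v} p e hp => ?_) p
  · refine (congrArg coord (act_id_apply _ (𝟙 (vertex l)) x)).trans ?_
    split_ifs with h
    · rfl
    · exact coord_eq_zero (fun h' => h h'.1) x
  · refine (congrArg coord (act_comp_apply _ (i := vertex l) (j := vertex u) (l := vertex v)
      p ((Paths.of _).map e) x)).trans ?_
    refine (coord_act_of e _).trans ?_
    have hvu : Fin.val u = Fin.val v + 1 := e.down
    by_cases h : Fin.val i ≤ Fin.val v
    · have hu : Fin.val i ≤ Fin.val u := by omega
      exact (if_pos h).trans (hp.trans ((if_pos hu).trans (if_pos h).symm))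
    · exact (if_neg h).trans (if_neg h).symm

/-- The generator of an interval representation. -/
noncomputable def top {i j : Fin m} (h : i ≤ j) : (intervalRep k i j).obj (vertex j) :=
  single ⟨h, le_rfl⟩ 1

lemma eq_smul_act_top {i j l : Fin m} (h : i ≤ j) (hl : l ≤ j)
    (x : (intervalRep k i j).obj (vertex l)) :
    x = coord x • act (intervalRep k i j) (path hl) (top h) := by
  apply coord_injective
  rw [map_smul, coord_act]
  split_ifs with hil
  · simp [top]
  · simpa using coord_eq_zero (fun h' => hil h'.1) x

/-- A morphism from an interval representation is determined by the image of the generator. -/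
lemma hom_ext_top {i j : Fin m} (h : i ≤ j) {X : LinearRep k m} {f g : intervalRep k i j ⟶ X}
    (H : comp f (vertex j) (top h) = comp g (vertex j) (top h)) : f = g := by
  refine hom_ext_comp fun l x => ?_
  by_cases hl : l ≤ j
  · rw [eq_smul_act_top h hl x, map_smul, map_smul, comp_act_apply, comp_act_apply, H]
  · have hx : x = 0 := coord_injective (by
      rw [coord_eq_zero (fun h' => hl h'.2) x, map_zero])
    rw [hx, map_zero, map_zero]

/-- The morphism from an interval representation with a given image of the generator. -/
noncomputable def ofTop (i j : Fin m) {X : LinearRep k m} (v : X.obj (vertex j))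
    (hv : ∀ (l : Fin m) (hl : l ≤ j), l < i → act X (path hl) v = 0) :
    intervalRep k i j ⟶ X :=
  mkHom (fun l => if hl : l ≤ j then coord.smulRight (act X (path hl) v) else 0) (by
    intro l l' p x
    have hll := le_of_path p
    by_cases hl : l ≤ j
    · have hl' : l' ≤ j := hll.trans hl
      rw [dif_pos hl, dif_pos hl', LinearMap.smulRight_apply, LinearMap.smulRight_apply,
        map_smul, ← act_comp_apply, Subsingleton.elim (path hl ≫ p) (path hl'), coord_act]
      split_ifs with hi
      · rfl
      · rw [hv l' hl' (not_le.1 hi), smul_zero, smul_zero]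
    · have hx : x = 0 := coord_injective (by
        rw [coord_eq_zero (fun h' => hl h'.2) x, map_zero])
      simp only [hx, map_zero])

lemma comp_ofTop {i j : Fin m} (h : i ≤ j) {X : LinearRep k m} (v : X.obj (vertex j)) (hv) :
    comp (ofTop (k := k) i j v hv) (vertex j) (top h) = v := by
  rw [ofTop, comp_mkHom, dif_pos le_rfl, LinearMap.smulRight_apply, act_id_apply, top,
    coord_single, one_smul]

/-- The morphism to an interval representation given by a functional at its lowest vertex. -/
noncomputable def ofFunctional (i j : Fin m) {X : LinearRep k m} (φ : X.obj (vertex i) →ₗ[k] k)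
    (hφ : ∀ (l : Fin m) (hl : i ≤ l), j < l → ∀ x, φ (act X (path hl) x) = 0) :
    X ⟶ intervalRep k i j :=
  mkHom (fun l => if hl : i ≤ l ∧ l ≤ j then single hl ∘ₗ φ ∘ₗ act X (path hl.1) else 0) (by
    intro l l' p x
    have hll := le_of_path p
    apply coord_injective
    rw [coord_act]
    by_cases hl : i ≤ l ∧ l ≤ j
    · rw [dif_pos hl]
      by_cases hl' : i ≤ l'
      · rw [dif_pos ⟨hl', hll.trans hl.2⟩, if_pos hl']
        simp only [LinearMap.comp_apply, coord_single]
        rw [← act_comp_apply, Subsingleton.elim (p ≫ path hl') (path hl.1)]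
      · rw [if_neg hl', coord_eq_zero (fun h' => hl' h'.1)]
    · rw [dif_neg hl]
      simp only [LinearMap.zero_apply, map_zero, ite_self]
      -- If the path enters the interval from above `j`, the target component at `l` is zero, so `φ`
      -- must vanish on the image; this is `hφ`.
      by_cases hl' : i ≤ l' ∧ l' ≤ j
      · have hil : i ≤ l := hl'.1.trans hll
        rw [dif_pos hl']
        simp only [LinearMap.comp_apply, coord_single]
        rw [← act_comp_apply, Subsingleton.elim (p ≫ path hl'.1) (path hil)]
        exact hφ l hil (by by_contra hj; exact hl ⟨hil, not_lt.1 hj⟩) x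
      · exact coord_eq_zero hl' _)

lemma coord_comp_ofFunctional {i j : Fin m} (h : i ≤ j) {X : LinearRep k m}
    (φ : X.obj (vertex i) →ₗ[k] k) (hφ) (x : X.obj (vertex j)) :
    coord (comp (ofFunctional i j φ hφ) (vertex j) x) = φ (act X (path h) x) := by
  rw [ofFunctional, comp_mkHom, dif_pos ⟨h, le_rfl⟩]
  simp only [LinearMap.comp_apply, coord_single]

/-- Nonzero morphisms between interval representations exist exactly when the first interval ends
inside the second one and the second one starts inside the first one. -/
lemma exists_hom_ne_zero_iff {i j i' j' : Fin m} (h : i ≤ j) :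
    (∃ g : intervalRep k i j ⟶ intervalRep k i' j', g ≠ 0) ↔ i ≤ i' ∧ i' ≤ j ∧ j ≤ j' := by
  constructor
  · rintro ⟨g, hg⟩
    have hne : coord (comp g (vertex j) (top h)) ≠ 0 := by
      intro h0
      refine hg (hom_ext_top h (coord_injective ?_))
      rw [h0]
      exact (map_zero coord).symm
    have hj : i' ≤ j ∧ j ≤ j' := by
      by_contra hj
      exact hne (coord_eq_zero hj _)
    refine ⟨?_, hj⟩
    -- If `i' < i`, pushing the generator down to `i'` kills it in the source but preserves the
    -- nonzero coordinate of its image.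
    by_contra hi
    have h1 := comp_act_apply g (path hj.1) (top h)
    have h2 := congrArg coord h1
    rw [coord_act, if_pos le_rfl] at h2
    refine hne (h2.symm.trans ?_)
    have h3 : act (intervalRep k i j) (path hj.1) (top h) = 0 := coord_injective (by
      rw [coord_eq_zero (fun h' => hi h'.1), map_zero])
    rw [h3, map_zero, map_zero]
  · rintro ⟨h1, h2, h3⟩
    refine ⟨ofTop i j (single ⟨h2, h3⟩ 1) fun l hl hli => coord_injective ?_, fun h0 => ?_⟩
    · rw [coord_act, if_neg (fun h4 => absurd hli (not_lt.2 (h1.trans h4))), map_zero]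
    · have h4 := comp_ofTop (k := k) h (single ⟨h2, h3⟩ 1 : (intervalRep k i' j').obj (vertex j))
        fun l hl hli => coord_injective (by
          rw [coord_act, if_neg (fun h4 => absurd hli (not_lt.2 (h1.trans h4))), map_zero])
      rw [h0] at h4
      have h5 := congrArg coord h4
      rw [coord_single] at h5
      exact one_ne_zero (h5.symm.trans (map_zero coord))

lemma not_isZero_intervalRep {i j : Fin m} (h : i ≤ j) : ¬ IsZero (intervalRep k i j) := by
  intro h0
  obtain ⟨g, hg⟩ := (exists_hom_ne_zero_iff (k := k) h).2 ⟨le_rfl, h, le_rfl⟩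
  exact hg (h0.eq_of_src _ _)

/-- The only idempotent endomorphisms of an interval representation are `0` and `1`. -/
lemma idempotent_intervalRep {i j : Fin m} (h : i ≤ j) (e : intervalRep k i j ⟶ intervalRep k i j)
    (he : e ≫ e = e) : e = 0 ∨ e = 𝟙 _ := by
  have h1 : comp e (vertex j) (top h) = coord (comp e (vertex j) (top h)) • top h := by
    apply coord_injective
    rw [map_smul, top, coord_single, smul_eq_mul, mul_one]
  have h2 : comp e (vertex j) (comp e (vertex j) (top h)) = comp e (vertex j) (top h) := by
    rw [← comp_comp_apply, he]
  generalize coord (comp e (vertex j) (top h)) = c at h1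
  have h3 : c * c = c := by
    rw [h1, map_smul, h1] at h2
    have := congrArg coord h2
    simpa [top] using this
  rcases eq_or_ne c 0 with rfl | hc
  · left
    refine hom_ext_top h ?_
    rw [h1, zero_smul]
    rfl
  · right
    refine hom_ext_top h ?_
    rw [h1, mul_left_cancel₀ hc (h3.trans (mul_one c).symm), one_smul]
    rfl

/-- The projection onto the summand `Y` is an idempotent endomorphism. If it is `0` then `Y`
vanishes, and if it is `1` then `Z` does. -/
lemma indecomposable_intervalRep {i j : Fin m} (h : i ≤ j) :
    Indecomposable (intervalRep k i j) := by
  refine ⟨not_isZero_intervalRep h, fun Y Z φ => ?_⟩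
  rcases idempotent_intervalRep h (φ.hom ≫ biprod.fst ≫ biprod.inl ≫ φ.inv) (by simp) with h0 | h1
  · left
    rw [IsZero.iff_id_eq_zero]
    have := congrArg (fun g => biprod.inl ≫ φ.inv ≫ g ≫ φ.hom ≫ biprod.fst) h0
    simpa using this
  · right
    rw [IsZero.iff_id_eq_zero]
    have := congrArg (fun g => biprod.inr ≫ φ.inv ≫ g ≫ φ.hom ≫ biprod.snd) h1
    simpa using this.symm

/-! ### Decomposition of representations -/

/-- The total dimension of a representation. -/
noncomputable def totalDim (X : LinearRep k m) : ℕ :=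
  ∑ l : Fin m, Module.finrank k (X.obj (vertex l))

lemma totalDim_lt_of_iso_biprod {X Y Z : LinearRep k m} (φ : X ≅ Y ⊞ Z) (hY : ¬ IsZero Y) :
    totalDim Z < totalDim X := by
  have hle : ∀ l : Fin m, Module.finrank k (Y.obj (vertex l)) + Module.finrank k (Z.obj (vertex l))
      ≤ Module.finrank k (X.obj (vertex l)) := by
    intro l
    rw [← Module.finrank_prod]
    refine LinearMap.finrank_le_finrank_of_injective (f := LinearMap.coprod
      (comp (biprod.inl ≫ φ.inv) (vertex l)) (comp (biprod.inr ≫ φ.inv) (vertex l))) ?_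
    rw [injective_iff_map_eq_zero]
    rintro ⟨y, z⟩ h
    rw [LinearMap.coprod_apply] at h
    have h1 := congrArg (comp (φ.hom ≫ biprod.fst) (vertex l)) h
    have h2 := congrArg (comp (φ.hom ≫ biprod.snd) (vertex l)) h
    rw [map_add, map_zero, ← comp_comp_apply, ← comp_comp_apply] at h1 h2
    simp only [Category.assoc, Iso.inv_hom_id_assoc, biprod.inl_fst, biprod.inr_fst,
      biprod.inl_snd, biprod.inr_snd] at h1 h2
    have h1 : y + 0 = 0 := h1
    have h2 : 0 + z = 0 := h2
    rw [add_zero] at h1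
    rw [zero_add] at h2
    rw [h1, h2]
    rfl
  have hpos : ∃ l : Fin m, 0 < Module.finrank k (Y.obj (vertex l)) := by
    by_contra! H
    refine hY ((IsZero.iff_id_eq_zero _).2 (hom_ext_comp fun l x => ?_))
    have := Module.finrank_zero_iff.1 (Nat.le_zero.1 (H l))
    exact Subsingleton.elim _ _
  obtain ⟨l, hl⟩ := hpos
  exact Finset.sum_lt_sum (fun l _ => (Nat.le_add_left _ _).trans (hle l))
    ⟨l, Finset.mem_univ _, by have := hle l; omega⟩

/-- An interval representation is a retract of every nonzero representation. -/
lemma exists_retract_of_not_isZero {X : LinearRep k m} (hX : ¬ IsZero X) :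
    ∃ i j : Fin m, i ≤ j ∧ ∃ (f : intervalRep k i j ⟶ X) (g : X ⟶ intervalRep k i j),
      f ≫ g = 𝟙 _ := by
  classical
  have hne : (Finset.univ.filter fun l : Fin m => Nontrivial (X.obj (vertex l))).Nonempty := by
    by_contra H
    refine hX ((IsZero.iff_id_eq_zero _).2 (hom_ext_comp fun l x => ?_))
    have : ¬ Nontrivial (X.obj (vertex l)) := fun hl =>
      H ⟨l, Finset.mem_filter.2 ⟨Finset.mem_univ _, hl⟩⟩
    rw [not_nontrivial_iff_subsingleton] at this
    exact Subsingleton.elim _ _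
  -- Take `i` to be the lowest vertex where `X` is nonzero, so that every vector dies below `i`.
  obtain ⟨i, hi, hmin⟩ := Finset.exists_min_image _ id hne
  have hi := (Finset.mem_filter.1 hi).2
  have hne' : (Finset.univ.filter fun l : Fin m =>
      ∃ (hl : i ≤ l) (v : X.obj (vertex l)), act X (path hl) v ≠ 0).Nonempty := by
    obtain ⟨v, hv⟩ := exists_ne (0 : X.obj (vertex i))
    exact ⟨i, Finset.mem_filter.2 ⟨Finset.mem_univ _, le_rfl, v, by rwa [act_id_apply]⟩⟩
  -- Take `j` to be the highest vertex from which some vector `v` survives down to `i`. Any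
  -- functional at `i` then kills what comes from above `j`; one equal to `1` on the image of `v`
  -- splits the map given by `v`.
  obtain ⟨j, hj, hmax⟩ := Finset.exists_max_image _ id hne'
  obtain ⟨hij, v, hv⟩ := (Finset.mem_filter.1 hj).2
  obtain ⟨φ, hφ⟩ := Module.Projective.exists_dual_eq_one k hv
  have hlow : ∀ (l : Fin m) (hl : l ≤ j), l < i → act X (path hl) v = 0 := by
    intro l _ hli
    have : Subsingleton (X.obj (vertex l)) := by
      rw [← not_nontrivial_iff_subsingleton]
      exact fun hn => absurd (hmin l (Finset.mem_filter.2 ⟨Finset.mem_univ _, hn⟩)) (not_le.2 hli)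
    exact Subsingleton.elim _ _
  have hhigh : ∀ (l : Fin m) (hl : i ≤ l), j < l → ∀ x, φ (act X (path hl) x) = 0 := by
    intro l hl hjl x
    have : act X (path hl) x = 0 := by
      by_contra hx
      exact absurd (hmax l (Finset.mem_filter.2 ⟨Finset.mem_univ _, hl, x, hx⟩)) (not_le.2 hjl)
    rw [this, map_zero]
  refine ⟨i, j, hij, ofTop i j v hlow, ofFunctional i j φ hhigh, hom_ext_top hij ?_⟩
  apply coord_injective
  rw [comp_comp_apply, comp_ofTop hij, coord_comp_ofFunctional hij, hφ]
  rfl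

/-- Every nonzero representation has an interval representation as a direct summand. -/
lemma exists_iso_biprod_of_not_isZero {X : LinearRep k m} (hX : ¬ IsZero X) :
    ∃ i j : Fin m, i ≤ j ∧ ∃ Z : LinearRep k m, Nonempty (X ≅ intervalRep k i j ⊞ Z) ∧
      totalDim Z < totalDim X := by
  obtain ⟨i, j, hij, f, g, hfg⟩ := exists_retract_of_not_isZero hX
  have : IsSplitMono f := IsSplitMono.mk' ⟨g, hfg⟩
  have e : X ≅ intervalRep k i j ⊞ cokernel f :=
    biprod.uniqueUpToIso _ _ (isBilimitBinaryBiconeOfIsSplitMonoOfCokernel (cokernelIsCokernel f))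
  exact ⟨i, j, hij, _, ⟨e⟩, totalDim_lt_of_iso_biprod e (not_isZero_intervalRep hij)⟩

/-- The indecomposable representations are the interval representations. -/
lemma indecomposable_iff (X : LinearRep k m) :
    Indecomposable X ↔ ∃ i j : Fin m, i ≤ j ∧ Nonempty (X ≅ intervalRep k i j) := by
  constructor
  · intro hX
    obtain ⟨i, j, hij, Z, ⟨e⟩, -⟩ := exists_iso_biprod_of_not_isZero hX.1
    have hZ : IsZero Z := (hX.2 _ _ e).resolve_left (not_isZero_intervalRep hij)
    exact ⟨i, j, hij, ⟨e ≪≫ (isoBiprodZero hZ).symm⟩⟩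
  · rintro ⟨i, j, hij, ⟨e⟩⟩
    have h := indecomposable_intervalRep (k := k) hij
    exact ⟨fun h0 => h.1 (h0.of_iso e.symm), fun Y Z φ => h.2 Y Z (e.symm ≪≫ φ)⟩

/-- Induction on representations by splitting off interval representations. -/
lemma rep_induction {P : LinearRep k m → Prop} (zero : ∀ X, IsZero X → P X)
    (biprod : ∀ (X Z : LinearRep k m) (i j : Fin m), i ≤ j → (X ≅ intervalRep k i j ⊞ Z) →
      P Z → P X) (X : LinearRep k m) : P X := by
  induction hd : totalDim X using Nat.strong_induction_on generalizing X with
  | _ d ih =>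
    by_cases hX : IsZero X
    · exact zero X hX
    · obtain ⟨i, j, hij, Z, ⟨e⟩, hZ⟩ := exists_iso_biprod_of_not_isZero hX
      exact biprod X Z i j hij e (ih _ (hd ▸ hZ) Z rfl)

/-! ### Torsion pairs -/

section Torsion

variable {C : Type*} [Category C] [Abelian C] {G F : ObjectProperty C}

lemma IsTorsionPair.of_isZero (h : IsTorsionPair G F) {X : C} (hX : IsZero X) : G X :=
  (h.torsion_iff X).2 fun _ _ _ => hX.eq_of_src _ _

lemma IsTorsionPair.biprod_iff (h : IsTorsionPair G F) {X Y Z : C} (e : X ≅ Y ⊞ Z) :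
    G X ↔ G Y ∧ G Z := by
  constructor
  · intro hX
    rw [h.torsion_iff] at hX
    refine ⟨(h.torsion_iff Y).2 fun W hW g => ?_, (h.torsion_iff Z).2 fun W hW g => ?_⟩
    · have := congrArg (fun f => biprod.inl ≫ e.inv ≫ f) (hX W hW (e.hom ≫ biprod.fst ≫ g))
      simpa using this
    · have := congrArg (fun f => biprod.inr ≫ e.inv ≫ f) (hX W hW (e.hom ≫ biprod.snd ≫ g))
      simpa using this
  · rintro ⟨hY, hZ⟩
    refine (h.torsion_iff X).2 fun W hW g => ?_
    rw [← cancel_epi e.inv, comp_zero]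
    apply biprod.hom_ext'
    · rw [comp_zero]
      exact (h.torsion_iff Y).1 hY W hW _
    · rw [comp_zero]
      exact (h.torsion_iff Z).1 hZ W hW _

lemma IsTorsionPair.prop_of_iso (h : IsTorsionPair G F) {X Y : C} (e : X ≅ Y) (hX : G X) : G Y :=
  (h.torsion_iff Y).2 fun W hW g => by
    rw [← cancel_epi e.hom, comp_zero]
    exact (h.torsion_iff X).1 hX W hW _

lemma IsTorsionPair.torsionFree_prop_of_iso (h : IsTorsionPair G F) {X Y : C} (e : X ≅ Y)
    (hX : F X) : F Y :=
  (h.torsionFree_iff Y).2 fun W hW g => by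
    rw [← cancel_mono e.inv, zero_comp]
    exact (h.torsionFree_iff X).1 hX W hW _

lemma IsTorsionPair.torsionFree_unique {F' : ObjectProperty C} (h : IsTorsionPair G F)
    (h' : IsTorsionPair G F') : F = F' := by
  ext Y
  rw [h.torsionFree_iff, h'.torsionFree_iff]

end Torsion

/-- Inclusions of torsion classes can be tested on interval representations. -/
lemma IsTorsionPair.le_of_intervalRep {G F G' F' : ObjectProperty (LinearRep k m)}
    (h : IsTorsionPair G F) (h' : IsTorsionPair G' F')
    (H : ∀ i j : Fin m, i ≤ j → G (intervalRep k i j) → G' (intervalRep k i j)) : G ≤ G' := by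
  intro X
  induction X using rep_induction with
  | zero X hX => exact fun _ => h'.of_isZero hX
  | biprod X Z i j hij e ih =>
    rw [h.biprod_iff e, h'.biprod_iff e]
    exact fun hX => ⟨H i j hij hX.1, ih hX.2⟩

lemma torsion_eq_of_indecomposables_eq {G G' : ObjectProperty (LinearRep k m)}
    (h : IsTorsionClass G) (h' : IsTorsionClass G')
    (H : indecomposables G = indecomposables G') : G = G' := by
  obtain ⟨F, h⟩ := h
  obtain ⟨F', h'⟩ := h'
  refine le_antisymm (h.le_of_intervalRep h' fun i j hij hG => ?_)
    (h'.le_of_intervalRep h fun i j hij hG => ?_)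
  · exact (H.le _ ⟨hG, indecomposable_intervalRep hij⟩).1
  · exact (H.ge _ ⟨hG, indecomposable_intervalRep hij⟩).1

/-- The interval of natural numbers formed by the vertices `i, …, j` of the quiver. -/
abbrev interval (i j : Fin m) : ℕ × ℕ := (i + 1, j + 1)

lemma interval_mem {i j : Fin m} (h : i ≤ j) : interval i j ∈ innerIntervals 0 (m + 1) := by
  have h : (i : ℕ) ≤ j := h
  exact ⟨by dsimp; omega, by dsimp; omega, by dsimp; omega⟩

lemma exists_eq_interval {x : ℕ × ℕ} (hx : x ∈ innerIntervals 0 (m + 1)) :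
    ∃ i j : Fin m, i ≤ j ∧ interval i j = x := by
  obtain ⟨a, b⟩ := x
  obtain ⟨h1, h2, h3⟩ := hx
  dsimp only at h1 h2 h3
  exact ⟨⟨a - 1, by omega⟩, ⟨b - 1, by omega⟩, show a - 1 ≤ b - 1 by omega,
    Prod.ext (by dsimp; omega) (by dsimp; omega)⟩

lemma forall_hom_eq_zero_iff {i j i' j' : Fin m} (h : i ≤ j) :
    (∀ g : intervalRep k i j ⟶ intervalRep k i' j', g = 0) ↔
      ¬ IntervalHom (interval i j) (interval i' j') := by
  have := exists_hom_ne_zero_iff (k := k) (i' := i') (j' := j') h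
  rw [← not_iff_not, not_not]
  push Not
  rw [this]
  simp only [IntervalHom, add_le_add_iff_right, Fin.val_fin_le]

/-- The representations without nonzero morphisms to the interval representations in `E`. -/
def leftOrthogonal (k : Type u) [Field k] (m : ℕ) (E : Set (ℕ × ℕ)) :
    ObjectProperty (LinearRep k m) :=
  fun X => ∀ i j : Fin m, i ≤ j → interval i j ∈ E → ∀ g : X ⟶ intervalRep k i j, g = 0

/-- The representations without nonzero morphisms from the interval representations in `D`. -/
def rightOrthogonal (k : Type u) [Field k] (m : ℕ) (D : Set (ℕ × ℕ)) :
    ObjectProperty (LinearRep k m) :=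
  fun Y => ∀ i j : Fin m, i ≤ j → interval i j ∈ D → ∀ g : intervalRep k i j ⟶ Y, g = 0

lemma ClosedPair.leftOrthogonal_intervalRep_iff {D E : Set (ℕ × ℕ)}
    (h : ClosedPair 0 (m + 1) D E) {i j : Fin m} (hij : i ≤ j) :
    leftOrthogonal k m E (intervalRep k i j) ↔ interval i j ∈ D := by
  rw [h.left_iff _ (interval_mem hij)]
  constructor
  · intro H y hy hE
    obtain ⟨i', j', hij', rfl⟩ := exists_eq_interval hy
    exact (forall_hom_eq_zero_iff hij).1 (H i' j' hij' hE)
  · exact fun H i' j' hij' hE => (forall_hom_eq_zero_iff hij).2 (H _ (interval_mem hij') hE)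

lemma ClosedPair.rightOrthogonal_intervalRep_iff {D E : Set (ℕ × ℕ)}
    (h : ClosedPair 0 (m + 1) D E) {i j : Fin m} (hij : i ≤ j) :
    rightOrthogonal k m D (intervalRep k i j) ↔ interval i j ∈ E := by
  rw [h.right_iff _ (interval_mem hij)]
  constructor
  · intro H y hy hE
    obtain ⟨i', j', hij', rfl⟩ := exists_eq_interval hy
    exact (forall_hom_eq_zero_iff hij').1 (H i' j' hij' hE)
  · exact fun H i' j' hij' hE => (forall_hom_eq_zero_iff hij').2 (H _ (interval_mem hij') hE)

/-- A closed pair of sets of intervals gives a torsion pair. -/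
lemma ClosedPair.isTorsionPair {D E : Set (ℕ × ℕ)} (h : ClosedPair 0 (m + 1) D E) :
    IsTorsionPair (leftOrthogonal k m E) (rightOrthogonal k m D) := by
  -- Splitting off summands of `X` suffices: an interval summand inherits left orthogonality, so it
  -- lies in `D`, and `Y` receives no nonzero morphism from it by definition.
  have key : ∀ X : LinearRep k m, leftOrthogonal k m E X →
      ∀ Y, rightOrthogonal k m D Y → ∀ g : X ⟶ Y, g = 0 := by
    intro X
    induction X using rep_induction with
    | zero X hX => exact fun _ _ _ _ => hX.eq_of_src _ _
    | biprod X Z i j hij e ih =>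
      intro hX Y hY g
      rw [← cancel_epi e.inv, comp_zero]
      apply biprod.hom_ext'
      · rw [comp_zero]
        refine hY i j hij ((h.leftOrthogonal_intervalRep_iff (k := k) hij).1
          fun i' j' hij' hE f => ?_) _
        have := congrArg (fun f => biprod.inl ≫ e.inv ≫ f)
          (hX i' j' hij' hE (e.hom ≫ biprod.fst ≫ f))
        simpa using this
      · rw [comp_zero]
        refine ih (fun i' j' hij' hE f => ?_) Y hY _
        have := congrArg (fun f => biprod.inr ≫ e.inv ≫ f)
          (hX i' j' hij' hE (e.hom ≫ biprod.snd ≫ f))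
        simpa using this
  refine ⟨fun X => ⟨key X, fun H i j hij hE => ?_⟩,
    fun Y => ⟨fun hY X hX => key X hX Y hY, fun H i j hij hD => ?_⟩⟩
  · exact H _ ((h.rightOrthogonal_intervalRep_iff hij).2 hE)
  · exact H _ ((h.leftOrthogonal_intervalRep_iff hij).2 hD)

/-- The intervals of the interval representations in a full subcategory. -/
def intervals (G : ObjectProperty (LinearRep k m)) : Set (ℕ × ℕ) :=
  {x | ∃ i j : Fin m, i ≤ j ∧ interval i j = x ∧ G (intervalRep k i j)}

lemma interval_mem_intervals (G : ObjectProperty (LinearRep k m)) {i j : Fin m} (hij : i ≤ j) :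
    interval i j ∈ intervals G ↔ G (intervalRep k i j) := by
  refine ⟨fun ⟨i', j', _, h, hG⟩ => ?_, fun hG => ⟨i, j, hij, rfl, hG⟩⟩
  simp only [interval, Prod.mk.injEq, add_left_inj, Fin.val_inj] at h
  obtain ⟨rfl, rfl⟩ := h
  exact hG

/-- A torsion pair gives a closed pair of sets of intervals. -/
lemma IsTorsionPair.closedPair {G F : ObjectProperty (LinearRep k m)} (h : IsTorsionPair G F) :
    ClosedPair 0 (m + 1) (intervals G) (intervals F) := by
  constructor
  · intro x hx
    obtain ⟨i, j, hij, rfl⟩ := exists_eq_interval hx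
    rw [interval_mem_intervals G hij, h.torsion_iff]
    constructor
    · intro H y hy hF
      obtain ⟨i', j', hij', rfl⟩ := exists_eq_interval hy
      rw [interval_mem_intervals F hij'] at hF
      exact (forall_hom_eq_zero_iff hij).1 (H _ hF)
    -- Vanishing on the intervals of `F` spreads to all of `F`, because summands of `Y` lie in `F`
    -- again.
    · intro H Y
      induction Y using rep_induction with
      | zero Y hY => exact fun _ _ => hY.eq_of_tgt _ _
      | biprod Y Z i' j' hij' e ih =>
        intro hY g
        rw [h.torsionFree_iff] at hY
        rw [← cancel_mono e.hom, zero_comp]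
        apply biprod.hom_ext
        · rw [zero_comp]
          refine (forall_hom_eq_zero_iff hij).2 (H _ (interval_mem hij')
            ((interval_mem_intervals F hij').2 ((h.torsionFree_iff _).2 fun X hX f => ?_))) _
          have := congrArg (fun f => f ≫ e.hom ≫ biprod.fst) (hY X hX (f ≫ biprod.inl ≫ e.inv))
          simpa using this
        · rw [zero_comp]
          refine ih ((h.torsionFree_iff _).2 fun X hX f => ?_) _
          have := congrArg (fun f => f ≫ e.hom ≫ biprod.snd) (hY X hX (f ≫ biprod.inr ≫ e.inv))
          simpa using this
  · intro y hy
    obtain ⟨i, j, hij, rfl⟩ := exists_eq_interval hy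
    rw [interval_mem_intervals F hij, h.torsionFree_iff]
    constructor
    · intro H x hx hG
      obtain ⟨i', j', hij', rfl⟩ := exists_eq_interval hx
      rw [interval_mem_intervals G hij'] at hG
      exact (forall_hom_eq_zero_iff hij').1 (H _ hG)
    · intro H X
      induction X using rep_induction with
      | zero X hX => exact fun _ _ => hX.eq_of_src _ _
      | biprod X Z i' j' hij' e ih =>
        intro hX g
        rw [h.biprod_iff e] at hX
        rw [← cancel_epi e.inv, comp_zero]
        apply biprod.hom_ext'
        · rw [comp_zero]
          exact (forall_hom_eq_zero_iff hij').2 (H _ (interval_mem hij')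
            ((interval_mem_intervals G hij').2 hX.1)) _
        · rw [comp_zero]
          exact ih hX.2 _

/-! ### The torsion class of a tree -/

/-- The torsion class of a binary tree. -/
def treeTorsion (k : Type u) [Field k] (m : ℕ) (T : BinaryTree Unit) :
    ObjectProperty (LinearRep k m) :=
  leftOrthogonal k m (ascendingSegments T 0)

/-- With `m + 2` leaves the last one is `m + 1`, so the inner intervals are exactly those within `1,
…, m`. -/
lemma closedPair_of_numLeaves {T : BinaryTree Unit} (hT : T.numLeaves = m + 2) :
    ClosedPair 0 (m + 1) (descendingSegments T 0) (ascendingSegments T 0) := by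
  have h := closedPair_segments T 0
  rw [T.numLeaves_eq_numNodes_succ] at hT
  rwa [zero_add, show T.numNodes = m + 1 by omega] at h

lemma isTorsionPair_treeTorsion {T : BinaryTree Unit} (hT : T.numLeaves = m + 2) :
    IsTorsionPair (treeTorsion k m T) (rightOrthogonal k m (descendingSegments T 0)) :=
  (closedPair_of_numLeaves hT).isTorsionPair

lemma treeTorsion_intervalRep_iff {T : BinaryTree Unit} (hT : T.numLeaves = m + 2) {i j : Fin m}
    (hij : i ≤ j) : treeTorsion k m T (intervalRep k i j) ↔
      interval i j ∈ descendingSegments T 0 :=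
  (closedPair_of_numLeaves hT).leftOrthogonal_intervalRep_iff hij

lemma indecomposables_treeTorsion {T : BinaryTree Unit} (hT : T.numLeaves = m + 2) :
    indecomposables (treeTorsion k m T) = descendingBalls k m T := by
  have hpair := isTorsionPair_treeTorsion (k := k) hT
  ext X
  constructor
  · rintro ⟨hX, hi⟩
    obtain ⟨i, j, hij, ⟨e⟩⟩ := (indecomposable_iff X).1 hi
    exact ⟨i, j, hij, (treeTorsion_intervalRep_iff hT hij).1 (hpair.prop_of_iso e hX), ⟨e⟩⟩
  · rintro ⟨i, j, hij, hmem, ⟨e⟩⟩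
    exact ⟨hpair.prop_of_iso e.symm ((treeTorsion_intervalRep_iff hT hij).2 hmem),
      (indecomposable_iff X).2 ⟨i, j, hij, ⟨e⟩⟩⟩

lemma indecomposables_torsionFree {T : BinaryTree Unit} (hT : T.numLeaves = m + 2)
    {F : ObjectProperty (LinearRep k m)} (hF : IsTorsionPair (treeTorsion k m T) F) :
    indecomposables F = ascendingBalls k m T := by
  have hpair := isTorsionPair_treeTorsion (k := k) hT
  obtain rfl := hpair.torsionFree_unique hF
  have hiff {i j : Fin m} (hij : i ≤ j) :=
    (closedPair_of_numLeaves hT).rightOrthogonal_intervalRep_iff (k := k) hij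
  ext X
  constructor
  · rintro ⟨hX, hi⟩
    obtain ⟨i, j, hij, ⟨e⟩⟩ := (indecomposable_iff X).1 hi
    exact ⟨i, j, hij, (hiff hij).1 (hpair.torsionFree_prop_of_iso e hX), ⟨e⟩⟩
  · rintro ⟨i, j, hij, hmem, ⟨e⟩⟩
    exact ⟨hpair.torsionFree_prop_of_iso e.symm ((hiff hij).2 hmem),
      (indecomposable_iff X).2 ⟨i, j, hij, ⟨e⟩⟩⟩

lemma treeTorsion_injective {T T' : BinaryTree Unit} (hT : T.numLeaves = m + 2)
    (hT' : T'.numLeaves = m + 2) (h : treeTorsion k m T = treeTorsion k m T') : T = T' := by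
  have hn := T.numLeaves_eq_numNodes_succ
  have hn' := T'.numLeaves_eq_numNodes_succ
  refine eq_of_descendingSegments (p := 0) (by omega) fun x hx => ?_
  rw [zero_add, show T.numNodes = m + 1 by omega] at hx
  obtain ⟨i, j, hij, rfl⟩ := exists_eq_interval hx
  rw [← treeTorsion_intervalRep_iff (k := k) hT hij, h, treeTorsion_intervalRep_iff hT' hij]

/-- The closed pair of the given torsion pair is realised by a tree, whose torsion class contains
the same interval representations and therefore coincides with `G`. -/
lemma exists_treeTorsion_eq {G : ObjectProperty (LinearRep k m)} (hG : IsTorsionClass G) :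
    ∃ T : BinaryTree Unit, T.numLeaves = m + 2 ∧ treeTorsion k m T = G := by
  obtain ⟨F, hGF⟩ := hG
  obtain ⟨T, hn, hD⟩ := hGF.closedPair.exists_tree (Nat.zero_le _)
  have hT : T.numLeaves = m + 2 := by
    rw [T.numLeaves_eq_numNodes_succ]
    omega
  have hiff (i j : Fin m) (hij : i ≤ j) :
      treeTorsion k m T (intervalRep k i j) ↔ G (intervalRep k i j) := by
    rw [treeTorsion_intervalRep_iff hT hij, hD _ (interval_mem hij), interval_mem_intervals G hij]
  have hpair := isTorsionPair_treeTorsion (k := k) hT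
  exact ⟨T, hT, le_antisymm (hpair.le_of_intervalRep hGF fun i j hij => (hiff i j hij).1)
    (hGF.le_of_intervalRep hpair fun i j hij => (hiff i j hij).2)⟩

lemma TamariLE.treeTorsion_le {T T' : BinaryTree Unit} (hT : T.numLeaves = m + 2)
    (hT' : T'.numLeaves = m + 2) (h : TamariLE T T') :
    treeTorsion k m T' ≤ treeTorsion k m T :=
  (isTorsionPair_treeTorsion hT').le_of_intervalRep (isTorsionPair_treeTorsion hT)
    fun i j hij => by
      rw [treeTorsion_intervalRep_iff hT hij, treeTorsion_intervalRep_iff hT' hij]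
      exact fun hx => h.descendingSegments_subset 0 hx

end TreeTorsion

theorem mainTheorem1 (k : Type u) [Field k] (n : ℕ) (hn : 1 ≤ n) :
    -- a torsion class is determined by the indecomposable objects in it
    (∀ G G' : ObjectProperty (TreeTorsion.LinearRep k (n - 1)),
      TreeTorsion.IsTorsionClass G → TreeTorsion.IsTorsionClass G' →
      TreeTorsion.indecomposables G = TreeTorsion.indecomposables G' → G = G') ∧
    ∃ f : {T : BinaryTree Unit // T.numLeaves = n + 1} →
        {G : ObjectProperty (TreeTorsion.LinearRep k (n - 1)) // TreeTorsion.IsTorsionClass G},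
      Function.Bijective f ∧
      (∀ T, TreeTorsion.indecomposables (f T).1 =
        TreeTorsion.descendingBalls k (n - 1) T.1) ∧
      (∀ T F, TreeTorsion.IsTorsionPair (f T).1 F →
        TreeTorsion.indecomposables F = TreeTorsion.ascendingBalls k (n - 1) T.1) ∧
      (∀ T T', TreeTorsion.TamariLE T.1 T'.1 → (f T').1 ≤ (f T).1) ∧
      (∀ T T', TreeTorsion.TamariCover T.1 T'.1 → (f T').1 < (f T).1) := by
  -- Since `1 ≤ n`, the truncated subtraction is harmless and `n - 1 + 2 = n + 1`.
  have hm (T : {T : BinaryTree Unit // T.numLeaves = n + 1}) : T.1.numLeaves = n - 1 + 2 :=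
    T.2.trans (by omega)
  refine ⟨fun G G' => TreeTorsion.torsion_eq_of_indecomposables_eq,
    fun T => ⟨TreeTorsion.treeTorsion k (n - 1) T.1,
      _, TreeTorsion.isTorsionPair_treeTorsion (hm T)⟩, ⟨?_, ?_⟩, ?_, ?_, ?_, ?_⟩
  · exact fun T T' h => Subtype.ext
      (TreeTorsion.treeTorsion_injective (hm T) (hm T') (congrArg Subtype.val h))
  · rintro ⟨G, hG⟩
    obtain ⟨T, hT, rfl⟩ := TreeTorsion.exists_treeTorsion_eq hG
    exact ⟨⟨T, hT.trans (by omega)⟩, rfl⟩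
  · exact fun T => TreeTorsion.indecomposables_treeTorsion (hm T)
  · exact fun T F => TreeTorsion.indecomposables_torsionFree (hm T)
  · exact fun T T' h => h.treeTorsion_le (hm T) (hm T')
  · exact fun T T' h => lt_of_le_of_ne
      (TreeTorsion.TamariLE.treeTorsion_le (hm T) (hm T') (Relation.ReflTransGen.single h))
      fun heq => h.ne (TreeTorsion.treeTorsion_injective (hm T') (hm T) heq).symm
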